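/- Let $n>1$ be an integer and let $$D^{n,1}=\{(z_0,\dots,z_n)\in\mathbb C^{n+1} : -|z_0|^2+|z_1|^2+\cdots+|z_n|^2>0\}.$$ Let $\mathrm{Aut}(D^{n,1})$ be the group of all biholomorphic maps of $D^{n,1}$ onto itself, equipped with the compact-open topology, and let $$GU(n,1)=\{A\in GL(n+1,\mathbb C) : A^*JA=\nu J \text{ for some real } \nu>0\},\qquad J=\mathrm{diag}(-1,1,\dots,1),$$ with the topology induced from $GL(n+1,\mathbb C)$. Then $\mathrm{Aut}(D^{n,1})=GU(n,1)$: every $A\in GU(n,1)$ maps $D^{n,1}$ biholomorphically onto itself by $z\mapsto Az$, every automorphism of $D^{n,1}$ is of this form for exactly one $A\in GU(n,1)$, and the resulting bijection $GU(n,1)\to\mathrm{Aut}(D^{n,1})$ is an isomorphism of topological groups. -/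

import Mathlib

open scoped Matrix

/-- A self-map of an open subset `Ω` of a complex normed space is holomorphic if it is the
restriction of a function that is complex differentiable on `Ω`. -/
def IsHolomorphicSelfMap {E : Type*} [NormedAddCommGroup E] [NormedSpace ℂ E]
    (Ω : TopologicalSpace.Opens E) (f : Ω → Ω) : Prop :=
  ∃ F : E → E, DifferentiableOn ℂ F (Ω : Set E) ∧ ∀ z : Ω, F (z : E) = (f z : E)

theorem IsHolomorphicSelfMap.id {E : Type*} [NormedAddCommGroup E] [NormedSpace ℂ E]
    (Ω : TopologicalSpace.Opens E) : IsHolomorphicSelfMap Ω (fun z => z) :=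
  ⟨fun z => z, differentiableOn_id, fun _ => rfl⟩

theorem IsHolomorphicSelfMap.comp {E : Type*} [NormedAddCommGroup E] [NormedSpace ℂ E]
    {Ω : TopologicalSpace.Opens E} {f g : Ω → Ω} (hf : IsHolomorphicSelfMap Ω f)
    (hg : IsHolomorphicSelfMap Ω g) : IsHolomorphicSelfMap Ω (fun z => f (g z)) := by
  obtain ⟨F, hF, hFf⟩ := hf
  obtain ⟨G, hG, hGg⟩ := hg
  refine ⟨F ∘ G, hF.comp hG fun z hz => ?_, fun z => ?_⟩
  · rw [hGg ⟨z, hz⟩]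
    exact (g ⟨z, hz⟩).2
  · rw [Function.comp_apply, hGg, hFf]

theorem IsHolomorphicSelfMap.continuous {E : Type*} [NormedAddCommGroup E] [NormedSpace ℂ E]
    {Ω : TopologicalSpace.Opens E} {f : Ω → Ω} (hf : IsHolomorphicSelfMap Ω f) :
    Continuous f := by
  obtain ⟨F, hF, hFf⟩ := hf
  rw [continuous_induced_rng]
  have h : (fun z : Ω => F (z : E)) = Subtype.val ∘ f := funext hFf
  rw [← h]
  exact continuousOn_iff_continuous_domRestrict.1 hF.continuousOn

/-- The group `Aut(Ω)` of all biholomorphic maps of `Ω` onto itself, under composition. -/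
def Aut {E : Type*} [NormedAddCommGroup E] [NormedSpace ℂ E]
    (Ω : TopologicalSpace.Opens E) : Subgroup (Equiv.Perm Ω) where
  carrier := {f | IsHolomorphicSelfMap Ω f ∧ IsHolomorphicSelfMap Ω f.symm}
  one_mem' := ⟨IsHolomorphicSelfMap.id Ω, IsHolomorphicSelfMap.id Ω⟩
  mul_mem' := fun hf hg => ⟨hf.1.comp hg.1, hg.2.comp hf.2⟩
  inv_mem' := fun hf => ⟨hf.2, hf.1⟩

/-- An automorphism, viewed as a continuous map. -/
def Aut.toContinuousMap {E : Type*} [NormedAddCommGroup E] [NormedSpace ℂ E]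
    {Ω : TopologicalSpace.Opens E} (f : Aut Ω) : C(Ω, Ω) :=
  ⟨(f : Equiv.Perm Ω), f.2.1.continuous⟩

/-- `Aut(Ω)` carries the compact-open topology. -/
instance Aut.instTopologicalSpace {E : Type*} [NormedAddCommGroup E] [NormedSpace ℂ E]
    (Ω : TopologicalSpace.Opens E) : TopologicalSpace (Aut Ω) :=
  TopologicalSpace.induced Aut.toContinuousMap ContinuousMap.compactOpen

/-- The domain `D^{n,1}` of all `z ∈ ℂ^{n+1}` with `-|z₀|² + |z₁|² + ⋯ + |zₙ|² > 0`. -/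
def domainD (n : ℕ) : TopologicalSpace.Opens (Fin (n + 1) → ℂ) where
  carrier := {z | -‖z 0‖ ^ 2 + ∑ i : Fin n, ‖z i.succ‖ ^ 2 > 0}
  is_open' := isOpen_lt continuous_const (by fun_prop)

/-- The diagonal matrix `J = diag(-1, 1, …, 1)` of size `n + 1`. -/
def matrixJ (n : ℕ) : Matrix (Fin (n + 1)) (Fin (n + 1)) ℂ :=
  Matrix.diagonal fun i => if i = 0 then -1 else 1

/-- The group `GU(n,1)` of all `A ∈ GL(n+1, ℂ)` with `A* J A = ν J` for some real `ν > 0`,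
with the topology of `GL(n+1, ℂ)`. -/
def GU (n : ℕ) : Subgroup (GL (Fin (n + 1)) ℂ) where
  carrier := {A | ∃ ν : ℝ, 0 < ν ∧
    (A : Matrix (Fin (n + 1)) (Fin (n + 1)) ℂ)ᴴ * matrixJ n *
      (A : Matrix (Fin (n + 1)) (Fin (n + 1)) ℂ) = (ν : ℂ) • matrixJ n}
  one_mem' := ⟨1, one_pos, by simp⟩
  mul_mem' := by
    rintro A B ⟨ν, hν, hA⟩ ⟨μ, hμ, hB⟩
    refine ⟨ν * μ, mul_pos hν hμ, ?_⟩
    calc _ = (B : Matrix (Fin (n + 1)) (Fin (n + 1)) ℂ)ᴴ *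
          ((A : Matrix (Fin (n + 1)) (Fin (n + 1)) ℂ)ᴴ * matrixJ n * A) * B := by
          simp [Matrix.conjTranspose_mul, Matrix.mul_assoc]
      _ = _ := by
          rw [hA, Matrix.mul_smul, Matrix.smul_mul, hB, smul_smul]
          push_cast
          rfl
  inv_mem' := by
    rintro A ⟨ν, hν, hA⟩
    refine ⟨ν⁻¹, inv_pos.2 hν, ?_⟩
    have hν' : (ν : ℂ) ≠ 0 := by exact_mod_cast hν.ne'
    set B : Matrix (Fin (n + 1)) (Fin (n + 1)) ℂ :=
      ((A⁻¹ : GL (Fin (n + 1)) ℂ) : Matrix (Fin (n + 1)) (Fin (n + 1)) ℂ) with hBdef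
    have hAB : (A : Matrix (Fin (n + 1)) (Fin (n + 1)) ℂ) * B = 1 := Units.mul_inv A
    have hBA : Bᴴ * (A : Matrix (Fin (n + 1)) (Fin (n + 1)) ℂ)ᴴ = 1 := by
      rw [← Matrix.conjTranspose_mul, hAB, Matrix.conjTranspose_one]
    have h : matrixJ n = (ν : ℂ) • (Bᴴ * matrixJ n * B) := by
      calc matrixJ n = (Bᴴ * (A : Matrix (Fin (n + 1)) (Fin (n + 1)) ℂ)ᴴ) * matrixJ n *
            ((A : Matrix (Fin (n + 1)) (Fin (n + 1)) ℂ) * B) := by rw [hAB, hBA]; simp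
        _ = Bᴴ * ((A : Matrix (Fin (n + 1)) (Fin (n + 1)) ℂ)ᴴ * matrixJ n * A) * B := by
            simp only [Matrix.mul_assoc]
        _ = _ := by rw [hA, Matrix.mul_smul, Matrix.smul_mul]
    rw [Complex.ofReal_inv, eq_inv_smul_iff₀ hν']
    exact h.symm

open Set Filter Topology

/-- **Identity theorem** for holomorphic functions of several variables. -/
theorem DifferentiableOn.eqOn_of_isPreconnected_of_eventuallyEq {E F : Type*}
    [NormedAddCommGroup E] [NormedSpace ℂ E] [NormedAddCommGroup F] [NormedSpace ℂ F]
    [CompleteSpace F] {f g : E → F} {U : Set E} (hf : DifferentiableOn ℂ f U)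
    (hg : DifferentiableOn ℂ g U) (hU : IsOpen U) (hc : IsPreconnected U) {z : E} (hz : z ∈ U)
    (hfg : f =ᶠ[𝓝 z] g) : EqOn f g U := by
  set V : Set E := {x | f =ᶠ[𝓝 x] g} with hV
  have hVo : IsOpen V := isOpen_setOfPred_eventually_nhds
  suffices h : U ⊆ V from fun x hx => (h hx : f =ᶠ[𝓝 x] g).eq_of_nhds
  refine hc.subset_of_closure_inter_subset hVo ⟨z, hz, hfg⟩ ?_
  rintro p ⟨hpV, hpU⟩
  obtain ⟨r, hr, hrU⟩ := Metric.isOpen_iff.1 hU p hpU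
  obtain ⟨q, hqV, hqp⟩ := Metric.mem_closure_iff.1 hpV r hr
  have hqB : q ∈ Metric.ball p r := by rwa [Metric.mem_ball, dist_comm]
  refine Filter.mem_of_superset (Metric.ball_mem_nhds p hr) fun x hx => ?_
  let φ : ℂ → E := fun t => q + t • (x - q)
  have hφ : Differentiable ℂ φ := by fun_prop
  let S : Set ℂ := φ ⁻¹' Metric.ball p r
  have hS : IsOpen S := Metric.isOpen_ball.preimage hφ.continuous
  have hSc : Convex ℝ S := by
    intro s hs t ht a b ha hb hab
    have : φ (a • s + b • t) = a • φ s + b • φ t := by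
      have hq : q = a • q + b • q := by rw [← add_smul, hab, one_smul]
      simp only [φ, smul_add, add_smul, smul_assoc]
      nth_rewrite 1 [hq]
      abel
    simpa only [S, mem_preimage, this] using convex_ball p r hs ht ha hb hab
  have key : EqOn (f ∘ φ) (g ∘ φ) S := by
    have h1 : DifferentiableOn ℂ (f ∘ φ) S := (hf.mono hrU).comp hφ.differentiableOn fun _ h => h
    have h2 : DifferentiableOn ℂ (g ∘ φ) S := (hg.mono hrU).comp hφ.differentiableOn fun _ h => h
    refine (h1.analyticOnNhd hS).eqOn_of_preconnected_of_eventuallyEq (h2.analyticOnNhd hS)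
      hSc.isPreconnected (z₀ := 0) (by simpa [S, φ] using hqB) ?_
    have h0 : Tendsto φ (𝓝 0) (𝓝 q) := hφ.continuous.tendsto' _ _ (by simp [φ])
    exact h0.eventually hqV
  have := key (show (1 : ℂ) ∈ S by simpa [S, φ] using hx)
  simpa [φ] using this

/-- A circle integral depending holomorphically on a parameter is holomorphic. -/
theorem differentiableOn_circleIntegral {E F : Type*}
    [NormedAddCommGroup E] [NormedSpace ℂ E] [FiniteDimensional ℂ E]
    [NormedAddCommGroup F] [NormedSpace ℂ F] [FiniteDimensional ℂ F]
    {Φ : E × ℂ → F} {V : Set E} {W : Set (E × ℂ)} (hV : IsOpen V) (hW : IsOpen W)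
    (hΦ : DifferentiableOn ℂ Φ W) {c : ℂ} {R : ℝ}
    (h : ∀ z ∈ V, ∀ θ : ℝ, (z, circleMap c R θ) ∈ W) :
    DifferentiableOn ℂ (fun z => ∮ ζ in C(c, R), Φ (z, ζ)) V := by
  have : ProperSpace E := FiniteDimensional.proper ℂ E
  have : CompleteSpace F := FiniteDimensional.complete ℂ F
  have : ProperSpace F := FiniteDimensional.proper ℂ F
  intro z hz
  -- a compact tube around the circle over `z`
  have hK : IsCompact (Metric.sphere c |R|) := isCompact_sphere c |R|
  have hzK : ∀ ζ ∈ Metric.sphere c |R|, (z, ζ) ∈ W := by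
    intro ζ hζ
    rw [← range_circleMap] at hζ
    obtain ⟨θ, rfl⟩ := hζ
    exact h z hz θ
  obtain ⟨u, v, huo, -, hzu, hKv, huv⟩ := generalized_tube_lemma (isCompact_singleton (x := z)) hK hW
    (by rintro ⟨a, ζ⟩ ⟨ha, hζ⟩; obtain rfl : a = z := ha; exact hzK ζ hζ)
  obtain ⟨r, hr, hru⟩ := Metric.isOpen_iff.1 (huo.inter hV) z ⟨hzu rfl, hz⟩
  have hball : ∀ x ∈ Metric.ball z r, ∀ ζ ∈ Metric.sphere c |R|, (x, ζ) ∈ W :=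
    fun x hx ζ hζ => huv ⟨(hru hx).1, hKv hζ⟩
  have hcm : ∀ θ : ℝ, circleMap c R θ ∈ Metric.sphere c |R| := fun θ => by
    rw [← range_circleMap]; exact mem_range_self θ
  have hcomp : IsCompact (Metric.closedBall z (r / 2) ×ˢ Metric.sphere c |R|) :=
    (isCompact_closedBall z (r / 2)).prod hK
  have hsubW : Metric.closedBall z (r / 2) ×ˢ Metric.sphere c |R| ⊆ W := by
    rintro ⟨x, ζ⟩ ⟨hx, hζ⟩
    exact hball x (Metric.closedBall_subset_ball (by linarith) hx) ζ hζ
  obtain ⟨M, hM⟩ := hcomp.exists_bound_of_continuousOn (hΦ.continuousOn.mono hsubW)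
  have hdiff : ∀ x ∈ Metric.ball z r, ∀ ζ ∈ Metric.sphere c |R|,
      DifferentiableAt ℂ (fun y => Φ (y, ζ)) x := by
    intro x hx ζ hζ
    have h1 : DifferentiableAt ℂ Φ (x, ζ) := (hΦ _ (hball x hx ζ hζ)).differentiableAt
      (hW.mem_nhds (hball x hx ζ hζ))
    exact h1.comp x (by fun_prop : DifferentiableAt ℂ (fun y : E => (y, ζ)) x)
  have hbound : ∀ x ∈ Metric.ball z (r / 4), ∀ ζ ∈ Metric.sphere c |R|,
      ‖fderiv ℂ (fun y => Φ (y, ζ)) x‖ ≤ (2 * M) / (r / 4) := by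
    intro x hx ζ hζ
    have hsub : Metric.ball x (r / 4) ⊆ Metric.closedBall z (r / 2) := fun y hy => by
      rw [Metric.mem_ball] at hx hy
      rw [Metric.mem_closedBall]
      linarith [dist_triangle y x z]
    refine Complex.norm_fderiv_le_div_of_mapsTo_ball (fun y hy => ?_) (fun y hy => ?_) (by positivity)
    · exact (hdiff y (Metric.closedBall_subset_ball (by linarith) (hsub hy)) ζ
        hζ).differentiableWithinAt
    · rw [Metric.mem_closedBall, dist_eq_norm]
      have h1 := hM (y, ζ) ⟨hsub hy, hζ⟩
      have h2 := hM (x, ζ) ⟨hsub (Metric.mem_ball_self (by positivity)), hζ⟩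
      linarith [norm_sub_le (Φ (y, ζ)) (Φ (x, ζ))]
  have hcont : ∀ x ∈ Metric.ball z r, Continuous fun θ : ℝ => Φ (x, circleMap c R θ) := by
    intro x hx
    refine hΦ.continuousOn.comp_continuous (f := fun θ : ℝ => (x, circleMap c R θ)) ?_
      fun θ => hball x hx _ (hcm θ)
    exact continuous_const.prodMk (continuous_circleMap c R)
  have hderiv : Continuous (deriv (circleMap c R)) := by
    have : deriv (circleMap c R) = fun θ => circleMap 0 R θ * Complex.I := by
      ext; simp
    rw [this]; fun_prop
  have hcont' : ∀ x ∈ Metric.ball z r, Continuous fun θ : ℝ =>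
      deriv (circleMap c R) θ • Φ (x, circleMap c R θ) := by
    intro x hx
    exact hderiv.smul (hcont x hx)
  refine HasFDerivAt.differentiableAt (f' := ∫ θ in (0 : ℝ)..2 * Real.pi,
    deriv (circleMap c R) θ • fderiv ℂ (fun y => Φ (y, circleMap c R θ)) z) ?_
    |>.differentiableWithinAt
  unfold circleIntegral
  refine intervalIntegral.hasFDerivAt_integral_of_dominated_of_fderiv_le
    (F' := fun x θ => deriv (circleMap c R) θ • fderiv ℂ (fun y => Φ (y, circleMap c R θ)) x)
    (bound := fun _ => |R| * ((2 * M) / (r / 4)))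
    (Metric.ball_mem_nhds z (show 0 < r / 4 by positivity)) ?_ ?_ ?_ ?_ ?_ ?_
  · filter_upwards [Metric.ball_mem_nhds z hr] with x hx
    exact (hcont' x hx).aestronglyMeasurable
  · exact (hcont' z (Metric.mem_ball_self hr)).intervalIntegrable _ _
  · have h1 : ∀ θ : ℝ, fderiv ℂ (fun y => Φ (y, circleMap c R θ)) z =
        (fderiv ℂ Φ (z, circleMap c R θ)).comp (ContinuousLinearMap.inl ℂ E ℂ) := by
      intro θ
      have hd : DifferentiableAt ℂ Φ (z, circleMap c R θ) :=
        (hΦ _ (hzK _ (hcm θ))).differentiableAt (hW.mem_nhds (hzK _ (hcm θ)))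
      exact (hd.hasFDerivAt.comp z (hasFDerivAt_prodMk_left z (circleMap c R θ))).fderiv
    simp only [h1]
    borelize (E × ℂ)
    borelize ((E × ℂ) →L[ℂ] F)
    have hm : Measurable fun θ : ℝ => fderiv ℂ Φ (z, circleMap c R θ) :=
      (measurable_fderiv ℂ Φ).comp
        (continuous_const.prodMk (continuous_circleMap c R)).measurable
    have hs : MeasureTheory.StronglyMeasurable fun θ : ℝ => fderiv ℂ Φ (z, circleMap c R θ) := by
      have : ProperSpace ((E × ℂ) →L[ℂ] F) := FiniteDimensional.proper ℂ _
      exact hm.stronglyMeasurable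
    have hc2 : Continuous fun L : (E × ℂ) →L[ℂ] F => L.comp (ContinuousLinearMap.inl ℂ E ℂ) := by
      fun_prop
    exact (hderiv.stronglyMeasurable.smul (hc2.comp_stronglyMeasurable hs)).aestronglyMeasurable
  · refine Eventually.of_forall fun θ _ x hx => ?_
    rw [norm_smul]
    refine mul_le_mul ?_ (hbound x hx _ (hcm θ)) (norm_nonneg _) (abs_nonneg _)
    simp
  · exact intervalIntegrable_const
  · refine Eventually.of_forall fun θ _ x hx => ?_
    exact (hdiff x (Metric.ball_subset_ball (by linarith) hx) _ (hcm θ)).hasFDerivAt.const_smul _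

theorem mem_domainD {n : ℕ} {z : Fin (n + 1) → ℂ} :
    z ∈ domainD n ↔ ‖z 0‖ ^ 2 < ∑ i : Fin n, ‖z i.succ‖ ^ 2 := by
  change -‖z 0‖ ^ 2 + ∑ i : Fin n, ‖z i.succ‖ ^ 2 > 0 ↔ _
  constructor <;> intro h <;> linarith

theorem mem_domainD_of_norm_lt {n : ℕ} {z : Fin (n + 1) → ℂ} (i : Fin n)
    (h : ‖z 0‖ < ‖z i.succ‖) : z ∈ domainD n := by
  rw [mem_domainD]
  have h1 : ‖z i.succ‖ ^ 2 ≤ ∑ i : Fin n, ‖z i.succ‖ ^ 2 :=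
    Finset.single_le_sum (f := fun i : Fin n => ‖z i.succ‖ ^ 2) (fun _ _ => sq_nonneg _)
      (Finset.mem_univ i)
  exact (pow_lt_pow_left₀ h (norm_nonneg _) two_ne_zero).trans_le h1

theorem isPreconnected_domainD {n : ℕ} (hn : 0 < n) :
    IsPreconnected (domainD n : Set (Fin (n + 1) → ℂ)) := by
  let ψ : ℂ × (Fin n → ℂ) → Fin (n + 1) → ℂ := fun p =>
    Fin.cons (p.1 * (√(∑ i, ‖p.2 i‖ ^ 2) : ℝ)) p.2
  have hψ : Continuous ψ := by
    refine continuous_pi fun i => ?_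
    refine Fin.cases ?_ (fun i => ?_) i
    · simp only [ψ, Fin.cons_zero]; fun_prop
    · simp only [ψ, Fin.cons_succ]; fun_prop
  have hpos : ∀ v : Fin n → ℂ, v ≠ 0 → 0 < ∑ i, ‖v i‖ ^ 2 := by
    intro v hv
    obtain ⟨i, hi⟩ := Function.ne_iff.1 hv
    exact Finset.sum_pos' (fun _ _ => sq_nonneg _) ⟨i, Finset.mem_univ i, by
      have := norm_pos_iff.2 hi
      positivity⟩
  have hrank : 1 < Module.rank ℝ (Fin n → ℂ) := by
    rw [← Module.finrank_eq_rank]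
    have : Module.finrank ℝ (Fin n → ℂ) = n * 2 := by
      simp [Module.finrank_pi_fintype, Complex.finrank_real_complex]
    rw [this]
    exact_mod_cast (by omega : 1 < n * 2)
  have himg : (domainD n : Set (Fin (n + 1) → ℂ)) =
      ψ '' (Metric.ball (0 : ℂ) 1 ×ˢ ({0}ᶜ : Set (Fin n → ℂ))) := by
    ext z
    rw [SetLike.mem_coe, mem_domainD]
    constructor
    · intro h
      set v : Fin n → ℂ := fun i => z i.succ with hv
      set s : ℝ := ∑ i : Fin n, ‖v i‖ ^ 2 with hs
      have hs0 : 0 < s := (sq_nonneg _).trans_lt h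
      have hr : 0 < √s := Real.sqrt_pos.2 hs0
      have hr' : ((√s : ℝ) : ℂ) ≠ 0 := by exact_mod_cast hr.ne'
      refine ⟨(z 0 / (√s : ℝ), v), ⟨?_, ?_⟩, ?_⟩
      · rw [mem_ball_zero_iff, norm_div, Complex.norm_real, Real.norm_of_nonneg hr.le,
          div_lt_one hr]
        exact Real.lt_sqrt_of_sq_lt h
      · rintro (h0 : v = 0)
        simp [hs, h0] at hs0
      · ext i
        refine Fin.cases ?_ (fun i => ?_) i
        · simp only [ψ, Fin.cons_zero]
          exact div_mul_cancel₀ _ hr'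
        · simp [ψ, v]
    · rintro ⟨⟨w, v⟩, ⟨hw, hv⟩, rfl⟩
      have hs := hpos v hv
      rw [mem_ball_zero_iff] at hw
      simp only [ψ, Fin.cons_zero, Fin.cons_succ, norm_mul, Complex.norm_real, mul_pow,
        Real.norm_eq_abs, sq_abs, Real.sq_sqrt hs.le]
      have : ‖w‖ ^ 2 < 1 := by nlinarith [norm_nonneg w]
      nlinarith
  rw [himg]
  exact ((convex_ball (0 : ℂ) 1).isPreconnected.prod
    (isConnected_compl_singleton_of_one_lt_rank hrank 0).isPreconnected).image _ hψ.continuousOn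

/-- **Hartogs extension**: holomorphic functions on `D^{n,1}`, `n > 1`, extend to entire
functions. -/
theorem exists_differentiable_eqOn_domainD {n : ℕ} (hn : 1 < n) {F : Type*}
    [NormedAddCommGroup F] [NormedSpace ℂ F] [FiniteDimensional ℂ F] {f : (Fin (n + 1) → ℂ) → F}
    (hf : DifferentiableOn ℂ f (domainD n)) :
    ∃ g : (Fin (n + 1) → ℂ) → F, Differentiable ℂ g ∧ EqOn g f (domainD n) := by
  have : CompleteSpace F := FiniteDimensional.complete ℂ F
  let i₁ : Fin n := ⟨0, by omega⟩
  let i₂ : Fin n := ⟨1, hn⟩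
  set j : Fin (n + 1) := i₁.succ with hj
  set k : Fin (n + 1) := i₂.succ with hk
  have hj0 : (0 : Fin (n + 1)) ≠ j := (Fin.succ_ne_zero i₁).symm
  have hkj : k ≠ j := by simp [hj, hk, i₁, i₂]
  let Φ : (Fin (n + 1) → ℂ) × ℂ → F := fun p => (p.2 - p.1 j)⁻¹ • f (Function.update p.1 j p.2)
  let W : Set ((Fin (n + 1) → ℂ) × ℂ) :=
    {p | Function.update p.1 j p.2 ∈ domainD n ∧ p.2 - p.1 j ≠ 0}
  have hupd : Differentiable ℂ fun p : (Fin (n + 1) → ℂ) × ℂ => Function.update p.1 j p.2 := by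
    refine differentiable_pi.2 fun i => ?_
    by_cases hi : i = j
    · subst hi; simp only [Function.update_self]; fun_prop
    · simp only [Function.update_of_ne hi]; fun_prop
  have hW : IsOpen W := by
    refine ((domainD n).isOpen.preimage hupd.continuous).inter ?_
    exact isOpen_ne_fun (by fun_prop) continuous_const
  have hΦ : DifferentiableOn ℂ Φ W := by
    refine DifferentiableOn.smul (DifferentiableOn.inv (by fun_prop) fun p hp => hp.2) ?_
    exact hf.comp hupd.differentiableOn fun p hp => hp.1
  let U : ℝ → Set (Fin (n + 1) → ℂ) := fun R => {z | ‖z 0‖ < R ∧ ‖z j‖ < R}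
  have hUo : ∀ R, IsOpen (U R) := fun R =>
    (isOpen_lt (f := fun z : Fin (n + 1) → ℂ => ‖z 0‖) (by fun_prop) continuous_const).inter
      (isOpen_lt (f := fun z : Fin (n + 1) → ℂ => ‖z j‖) (by fun_prop) continuous_const)
  have hUc : ∀ R, IsPreconnected (U R) := by
    intro R
    have h : U R = (fun z : Fin (n + 1) → ℂ => (z 0, z j)) ⁻¹'
        (Metric.ball 0 R ×ˢ Metric.ball 0 R) := by
      ext z; simp [U]
    rw [h]
    exact (((convex_ball (0 : ℂ) R).prod (convex_ball (0 : ℂ) R)).is_linear_preimage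
      (f := fun z : Fin (n + 1) → ℂ => (z 0, z j)) ⟨fun _ _ => rfl, fun _ _ => rfl⟩).isPreconnected
  let H : ℝ → (Fin (n + 1) → ℂ) → F := fun R z =>
    (2 * Real.pi * Complex.I : ℂ)⁻¹ • ∮ ζ in C(0, R), Φ (z, ζ)
  have hH : ∀ R, DifferentiableOn ℂ (H R) (U R) := by
    intro R
    refine DifferentiableOn.const_smul (differentiableOn_circleIntegral (hUo R) hW hΦ ?_) _
    rintro z ⟨h0, h1⟩ θ
    have hR : 0 < R := (norm_nonneg _).trans_lt h0
    have hn : ‖circleMap 0 R θ‖ = R := by simp [abs_of_pos hR]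
    constructor
    · refine mem_domainD_of_norm_lt i₁ ?_
      rw [Function.update_of_ne hj0, ← hj, Function.update_self, hn]
      exact h0
    · intro h
      have h' : circleMap 0 R θ = z j := sub_eq_zero.1 h
      rw [← h', hn] at h1
      exact lt_irrefl _ h1
  let T : Set (Fin (n + 1) → ℂ) := {z | ‖z 0‖ < ‖z k‖}
  have hTo : IsOpen T := isOpen_lt (by fun_prop) (by fun_prop)
  have hHf : ∀ R, ∀ z ∈ U R ∩ T, H R z = f z := by
    rintro R z ⟨⟨h0, h1⟩, hT⟩
    have hR : 0 < R := (norm_nonneg _).trans_lt h0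
    have hg : Differentiable ℂ fun ζ : ℂ => f (Function.update z j ζ) := by
      intro ζ
      have hmem : Function.update z j ζ ∈ domainD n := by
        refine mem_domainD_of_norm_lt i₂ ?_
        rw [Function.update_of_ne hj0, ← hk, Function.update_of_ne hkj]
        exact hT
      refine DifferentiableAt.comp (g := f) ζ
        ((hf _ hmem).differentiableAt ((domainD n).isOpen.mem_nhds hmem)) ?_
      exact DifferentiableAt.comp (g := fun p : (Fin (n + 1) → ℂ) × ℂ => Function.update p.1 j p.2)
        (f := fun ζ => (z, ζ)) ζ (hupd _) (by fun_prop)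
    have := (hg.diffContOnCl (s := Metric.ball 0 R)).two_pi_i_inv_smul_circleIntegral_sub_inv_smul
      (w := z j) (by simpa using h1)
    simpa only [Function.update_eq_self] using this
  let e : Fin (n + 1) → ℂ := Pi.single k 1
  have heT : e ∈ T := by
    change ‖e 0‖ < ‖e k‖
    simp [e, hk, (Fin.succ_ne_zero i₂).symm]
  have heU : ∀ R, 0 < R → e ∈ U R := by
    intro R hR
    refine ⟨?_, ?_⟩
    · simpa [e, hk, (Fin.succ_ne_zero i₂).symm] using hR
    · rw [show e j = 0 from Pi.single_eq_of_ne hkj.symm _, norm_zero]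
      exact hR
  have hHH : ∀ r R, 0 < r → r ≤ R → EqOn (H r) (H R) (U r) := by
    intro r R hr hrR
    have hsub : U r ⊆ U R := fun z hz => ⟨hz.1.trans_le hrR, hz.2.trans_le hrR⟩
    refine (hH r).eqOn_of_isPreconnected_of_eventuallyEq ((hH R).mono hsub) (hUo r) (hUc r)
      (heU r hr) ?_
    filter_upwards [((hUo r).inter hTo).mem_nhds ⟨heU r hr, heT⟩] with z hz
    rw [hHf r z hz, hHf R z ⟨hsub hz.1, hz.2⟩]
  let ρ : (Fin (n + 1) → ℂ) → ℝ := fun z => ‖z 0‖ + ‖z j‖ + 1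
  have hρU : ∀ z, z ∈ U (ρ z) := fun z =>
    ⟨by simp only [ρ]; linarith [norm_nonneg (z j)], by simp only [ρ]; linarith [norm_nonneg (z 0)]⟩
  have hρ0 : ∀ z, 0 < ρ z := fun z => by positivity
  have hloc : ∀ R, 0 < R → ∀ z ∈ U R, H (ρ z) z = H R z := by
    intro R hR z hz
    rcases le_total (ρ z) R with h | h
    · exact hHH _ _ (hρ0 z) h (hρU z)
    · exact (hHH _ _ hR h hz).symm
  have hg : Differentiable ℂ fun z => H (ρ z) z := by
    intro z
    refine (((hH _) z (hρU z)).differentiableAt ((hUo _).mem_nhds (hρU z))).congr_of_eventuallyEq ?_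
    filter_upwards [(hUo _).mem_nhds (hρU z)] with y hy
    exact hloc _ (hρ0 z) y hy
  refine ⟨fun z => H (ρ z) z, hg, ?_⟩
  refine hg.differentiableOn.eqOn_of_isPreconnected_of_eventuallyEq hf (domainD n).isOpen
    (isPreconnected_domainD (by omega)) (mem_domainD_of_norm_lt i₂ heT) ?_
  filter_upwards [hTo.mem_nhds heT] with z hz
  exact hHf _ z ⟨hρU z, hz⟩

/-- If `‖a‖ ≤ ‖b‖` for entire functions `a`, `b` of one variable, and `b` has no zero except
possibly at the origin, then `a` is a constant multiple of `b`. -/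
theorem Differentiable.exists_eq_mul_of_norm_le {a b : ℂ → ℂ} (ha : Differentiable ℂ a)
    (hb : Differentiable ℂ b) (hab : ∀ t, ‖a t‖ ≤ ‖b t‖) (hb0 : ∀ t, t ≠ 0 → b t ≠ 0) :
    ∃ c, ∀ t, a t = c * b t := by
  let q : ℂ → ℂ := fun t => a t / b t
  have hq1 : ∀ t, ‖q t‖ ≤ 1 := fun t => by
    simp only [q, norm_div]
    exact div_le_one_of_le₀ (hab t) (norm_nonneg _)
  have hd : DifferentiableOn ℂ q (univ \ {0}) :=
    ha.differentiableOn.div hb.differentiableOn fun t ht => hb0 t ht.2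
  have hu := Complex.differentiableOn_update_limUnder_of_bddAbove (c := 0) univ_mem hd
    ⟨1, by rintro _ ⟨t, -, rfl⟩; exact hq1 t⟩
  rw [differentiableOn_univ] at hu
  obtain ⟨c, hc⟩ := hu.exists_const_forall_eq_of_bounded <| by
    refine isBounded_iff_forall_norm_le.2
      ⟨max 1 ‖limUnder (𝓝[≠] 0) q‖, forall_mem_range.2 fun t => ?_⟩
    rcases eq_or_ne t 0 with rfl | ht
    · rw [Function.update_self]; exact le_max_right _ _
    · rw [Function.update_of_ne ht]; exact (hq1 t).trans (le_max_left _ _)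
  refine ⟨c, congrFun (Continuous.ext_on (dense_compl_singleton 0) ha.continuous
    (continuous_const.mul hb.continuous) fun t (ht : t ≠ 0) => ?_)⟩
  have h := hc t
  rw [Function.update_of_ne ht] at h
  rw [← h, div_mul_cancel₀ _ (hb0 t ht)]

/-- A proper entire function of one variable fixing the origin with derivative one there, and with
no other zero, is the identity. -/
theorem Differentiable.eq_self_of_tendsto_cocompact {b : ℂ → ℂ} (hb : Differentiable ℂ b)
    (h0 : b 0 = 0) (h1 : _root_.deriv b 0 = 1) (hne : ∀ t, t ≠ 0 → b t ≠ 0)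
    (hlim : Tendsto b (cocompact ℂ) (cocompact ℂ)) (t : ℂ) : b t = t := by
  have hdsl : ∀ {f : ℂ → ℂ}, Differentiable ℂ f → Differentiable ℂ (dslope f 0) := fun hf => by
    rw [← differentiableOn_univ] at hf ⊢
    exact (Complex.differentiableOn_dslope univ_mem).2 hf
  set u := dslope b 0 with hu
  have hbu : ∀ t, b t = t * u t := fun t => by
    simpa [h0] using (sub_smul_dslope b 0 t).symm
  have hu0 : u 0 = 1 := by rw [hu, dslope_same, h1]
  have hune : ∀ t, u t ≠ 0 := by
    intro t ht
    rcases eq_or_ne t 0 with rfl | h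
    · exact one_ne_zero (hu0.symm.trans ht)
    · exact hne t h (by rw [hbu, ht, mul_zero])
  let v : ℂ → ℂ := fun t => (u t)⁻¹
  have hv : Differentiable ℂ v := (hdsl hb).inv hune
  have hv0 : v 0 = 1 := by simp [v, hu0]
  have hw : Tendsto (dslope v 0) (cocompact ℂ) (𝓝 0) := by
    have hlim0 : Tendsto (fun t => (b t)⁻¹ - t⁻¹) (cocompact ℂ) (𝓝 0) := by
      rw [← Metric.cobounded_eq_cocompact] at hlim ⊢
      simpa using (tendsto_inv₀_cobounded.comp hlim).sub (tendsto_inv₀_cobounded (α := ℂ))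
    refine hlim0.congr' ?_
    have : ∀ᶠ t : ℂ in cocompact ℂ, t ≠ 0 :=
      (isCompact_singleton (x := (0 : ℂ))).compl_mem_cocompact
    filter_upwards [this] with t ht
    have := hune t
    rw [dslope_of_ne _ ht, slope_def_field, hbu t, hv0]
    simp only [v]
    field_simp
    ring
  have hz : dslope v 0 t = 0 := (hdsl hv).apply_eq_of_tendsto_cocompact t hw
  have hvt : v t = 1 := by
    have := sub_smul_dslope v 0 t
    rw [hz, smul_zero, hv0] at this
    exact (sub_eq_zero.1 this.symm)
  rw [hbu, ← inv_inv (u t)]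
  change t * (v t)⁻¹ = t
  rw [hvt, inv_one, mul_one]

/-- A proper entire self-map of `ℂ^ι` that maps every complex line through the origin into itself,
is tangent to the identity at the origin, and has no other zero, is the identity. -/
theorem Differentiable.eq_self_of_preserves_lines {ι : Type*} [Fintype ι]
    {H : (ι → ℂ) → ι → ℂ} (hH : Differentiable ℂ H) (h0 : H 0 = 0)
    (h1 : HasFDerivAt H (ContinuousLinearMap.id ℂ (ι → ℂ)) 0) (hne : ∀ z, z ≠ 0 → H z ≠ 0)
    (hlim : Tendsto H (cocompact _) (cocompact _)) (hl : ∀ z i j, H z i * z j = H z j * z i)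
    (z : ι → ℂ) : H z = z := by
  rcases eq_or_ne z 0 with rfl | hz
  · exact h0
  obtain ⟨i, hi⟩ := Function.ne_iff.1 hz
  replace hi : z i ≠ 0 := hi
  let b : ℂ → ℂ := fun t => H (t • z) i / z i
  have hbz : ∀ t, H (t • z) = b t • z := by
    intro t
    ext j
    rcases eq_or_ne t 0 with rfl | ht
    · simp [b, h0]
    · have := hl (t • z) i j
      simp only [Pi.smul_apply, smul_eq_mul] at this
      simp only [b, Pi.smul_apply, smul_eq_mul]
      field_simp
      refine mul_left_cancel₀ ht ?_
      linear_combination -this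
  have hline : Differentiable ℂ fun t : ℂ => t • z := by fun_prop
  have hb : Differentiable ℂ b :=
    (differentiable_pi.1 (hH.comp hline) i).div_const _
  have hderiv : HasDerivAt b 1 0 := by
    have h2 : HasDerivAt (fun t : ℂ => t • z) z 0 := by
      simpa using (hasDerivAt_id (0 : ℂ)).smul_const z
    have h3 : HasDerivAt (fun t : ℂ => H (t • z)) z 0 := by
      have h1' : HasFDerivAt H (ContinuousLinearMap.id ℂ (ι → ℂ)) ((0 : ℂ) • z) := by
        rwa [zero_smul]
      exact h1'.comp_hasDerivAt (0 : ℂ) h2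
    simpa [b, div_self hi] using (hasDerivAt_pi.1 h3 i).div_const (z i)
  have hb1 := hb.eq_self_of_tendsto_cocompact (by simp [b, h0]) hderiv.deriv ?_ ?_ 1
  · simpa [hb1] using hbz 1
  · intro t ht hbt
    refine hne (t • z) (smul_ne_zero ht hz) ?_
    rw [hbz, hbt, zero_smul]
  · have hzn : 0 < ‖z‖ := norm_pos_iff.2 hz
    rw [← Metric.cobounded_eq_cocompact, ← tendsto_norm_atTop_iff_cobounded]
    simp only [← Metric.cobounded_eq_cocompact] at hlim
    have ht : Tendsto (fun t : ℂ => t • z) (Bornology.cobounded ℂ) (Bornology.cobounded _) := by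
      rw [← tendsto_norm_atTop_iff_cobounded]
      simp only [norm_smul]
      exact tendsto_norm_cobounded_atTop.atTop_mul_const hzn
    have h4 := tendsto_norm_atTop_iff_cobounded.2 (hlim.comp ht)
    refine (h4.atTop_mul_const (inv_pos.2 hzn)).congr fun t => ?_
    simp only [Function.comp_apply, hbz, norm_smul]
    field_simp

theorem norm_apply_le_of_notMem_domainD {n : ℕ} {z : Fin (n + 1) → ℂ} (hz : z ∉ domainD n)
    (i : Fin (n + 1)) : ‖z i‖ ≤ ‖z 0‖ := by
  refine Fin.cases le_rfl (fun i => ?_) i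
  by_contra! h
  exact hz (mem_domainD_of_norm_lt i h)

theorem apply_zero_ne_zero_of_notMem_domainD {n : ℕ} {z : Fin (n + 1) → ℂ} (hz : z ∉ domainD n)
    (h0 : z ≠ 0) : z 0 ≠ 0 := by
  intro h
  refine h0 (funext fun i => norm_le_zero_iff.1 ?_)
  simpa [h] using norm_apply_le_of_notMem_domainD hz i

theorem smul_mem_domainD_iff {n : ℕ} {z : Fin (n + 1) → ℂ} {t : ℂ} (ht : t ≠ 0) :
    t • z ∈ domainD n ↔ z ∈ domainD n := by
  have : 0 < ‖t‖ ^ 2 := by positivity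
  simp only [mem_domainD, Pi.smul_apply, smul_eq_mul, norm_mul, mul_pow, ← Finset.mul_sum]
  exact mul_lt_mul_iff_right₀ this

theorem zero_notMem_domainD {n : ℕ} : (0 : Fin (n + 1) → ℂ) ∉ domainD n := by
  simp [mem_domainD]

theorem smul_notMem_domainD {n : ℕ} {z : Fin (n + 1) → ℂ} (hz : z ∉ domainD n) (t : ℂ) :
    t • z ∉ domainD n := by
  rcases eq_or_ne t 0 with rfl | ht
  · rw [zero_smul]; exact zero_notMem_domainD
  · rwa [smul_mem_domainD_iff ht]

/-- An entire map preserving the complement of `D^{n,1}` maps each line of that complement into a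
line, provided that its zeros on this line are at the origin. -/
theorem apply_smul_mul_apply_smul {n : ℕ} {F : (Fin (n + 1) → ℂ) → Fin (n + 1) → ℂ}
    (hF : Differentiable ℂ F) (hD : ∀ z, z ∉ domainD n → F z ∉ domainD n) {z : Fin (n + 1) → ℂ}
    (hz : z ∉ domainD n) (hne : ∀ t : ℂ, t ≠ 0 → F (t • z) ≠ 0) (i : Fin (n + 1)) (s t : ℂ) :
    F (s • z) i * F (t • z) 0 = F (t • z) i * F (s • z) 0 := by
  have hK : ∀ t : ℂ, F (t • z) ∉ domainD n := fun t => hD _ (smul_notMem_domainD hz t)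
  have hd : Differentiable ℂ fun t : ℂ => F (t • z) := by fun_prop
  obtain ⟨c, hc⟩ := (differentiable_pi.1 hd i).exists_eq_mul_of_norm_le (differentiable_pi.1 hd 0)
    (fun t => norm_apply_le_of_notMem_domainD (hK t) i)
    (fun t ht => apply_zero_ne_zero_of_notMem_domainD (hK t) (hne t ht))
  rw [hc, hc]
  ring

/-- An entire automorphism preserving `D^{n,1}` fixes the origin. -/
theorem apply_zero_eq_zero_of_preserves_domainD {n : ℕ} (hn : 0 < n)
    {F G : (Fin (n + 1) → ℂ) → Fin (n + 1) → ℂ} (hF : Differentiable ℂ F)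
    (hFG : Function.LeftInverse F G) (hGF : Function.LeftInverse G F)
    (hFD : ∀ z, F z ∈ domainD n ↔ z ∈ domainD n) : F 0 = 0 := by
  by_contra hF0
  set p := G 0 with hp
  have hFp : F p = 0 := hFG 0
  have hp0 : p ≠ 0 := fun h => hF0 (h ▸ hFp)
  have hpK : p ∉ domainD n := by rw [← hFD, hFp]; exact zero_notMem_domainD
  have hp00 : p 0 ≠ 0 := apply_zero_ne_zero_of_notMem_domainD hpK hp0
  let k : Fin (n + 1) := Fin.succ ⟨0, hn⟩
  have hk0 : k ≠ 0 := Fin.succ_ne_zero _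
  -- an open subset of the complement, none of whose points is proportional to `p`
  let S : Set (Fin (n + 1) → ℂ) :=
    {z | ∑ i : Fin n, ‖z i.succ‖ ^ 2 < ‖z 0‖ ^ 2} ∩ {z | z k * p 0 ≠ z 0 * p k}
  have hSo : IsOpen S := (isOpen_lt (by fun_prop) (by fun_prop)).inter
    (isOpen_ne_fun (by fun_prop) (by fun_prop))
  obtain ⟨q, hq⟩ : S.Nonempty := by
    obtain ⟨a, ha1, ha⟩ : ∃ a : ℂ, ‖a‖ ^ 2 < 1 ∧ a * p 0 ≠ p k := by
      rcases eq_or_ne (p k) 0 with h | h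
      · exact ⟨1 / 2, by norm_num, by rw [h]; exact mul_ne_zero (by norm_num) hp00⟩
      · exact ⟨0, by simp, by simpa using h.symm⟩
    refine ⟨Function.update (Pi.single k a) 0 1, ?_, ?_⟩
    · simp only [mem_ofPred_eq, Function.update_self, norm_one, one_pow,
        Function.update_of_ne (Fin.succ_ne_zero _)]
      rw [Finset.sum_eq_single ⟨0, hn⟩]
      · simpa [k] using ha1
      · intro i _ hi
        rw [Pi.single_eq_of_ne (by simpa [k] using (Fin.succ_injective n).ne hi)]
        simp
      · simp
    · simp only [mem_ofPred_eq, Function.update_self, Function.update_of_ne hk0, Pi.single_eq_same,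
        one_mul]
      exact ha
  have hS : ∀ z ∈ S, ∀ i, F z i * F 0 0 = F 0 i * F z 0 := by
    rintro z ⟨hz1, hz2⟩ i
    have hz : z ∉ domainD n := by rw [mem_domainD]; exact not_lt.2 hz1.le
    have := apply_smul_mul_apply_smul hF (fun z hz => by rwa [hFD]) hz ?_ i 1 0
    · simpa using this
    · intro t ht h
      have htp : t • z = p := by rw [← hGF (t • z), h]
      refine hz2 ?_
      rw [← htp]
      simp only [Pi.smul_apply, smul_eq_mul]
      ring
  have hall : ∀ z i, F z i * F 0 0 = F 0 i * F z 0 := by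
    intro z i
    have h1 : Differentiable ℂ fun z => F z i * F 0 0 := (differentiable_pi.1 hF i).mul_const _
    have h2 : Differentiable ℂ fun z => F 0 i * F z 0 := (differentiable_pi.1 hF 0).const_mul _
    refine h1.differentiableOn.eqOn_of_isPreconnected_of_eventuallyEq h2.differentiableOn isOpen_univ
      isPreconnected_univ (mem_univ q) ?_ (mem_univ z)
    filter_upwards [hSo.mem_nhds hq] with z hz using hS z hz i
  have hF00 : F 0 0 ≠ 0 := apply_zero_ne_zero_of_notMem_domainD
    (by rw [hFD]; exact zero_notMem_domainD) hF0
  have := hall (G (Pi.single k 1)) k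
  rw [hFG, Pi.single_eq_same, Pi.single_eq_of_ne hk0.symm, mul_zero, one_mul] at this
  exact hF00 this

/-- An entire automorphism preserving `D^{n,1}` is linear. -/
theorem eq_fderiv_of_preserves_domainD {n : ℕ} (hn : 0 < n)
    {F G : (Fin (n + 1) → ℂ) → Fin (n + 1) → ℂ} (hF : Differentiable ℂ F)
    (hG : Differentiable ℂ G) (hFG : Function.LeftInverse F G) (hGF : Function.LeftInverse G F)
    (hFD : ∀ z, F z ∈ domainD n ↔ z ∈ domainD n) (z : Fin (n + 1) → ℂ) :
    F z = fderiv ℂ F 0 z := by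
  have hF0 : F 0 = 0 := apply_zero_eq_zero_of_preserves_domainD hn hF hFG hGF hFD
  have hG0 : G 0 = 0 := by rw [← hF0, hGF, hF0]
  set L := fderiv ℂ F 0 with hL
  set M := fderiv ℂ G 0 with hM
  have hFL : HasFDerivAt F L 0 := (hF 0).hasFDerivAt
  have hGM : HasFDerivAt G M 0 := (hG 0).hasFDerivAt
  have hML : M.comp L = ContinuousLinearMap.id ℂ _ := by
    have h1 : HasFDerivAt (G ∘ F) (M.comp L) 0 := HasFDerivAt.comp 0 (by rwa [hF0]) hFL
    rw [hGF.comp_eq_id] at h1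
    exact h1.unique (hasFDerivAt_id 0)
  have hLM : L.comp M = ContinuousLinearMap.id ℂ _ := by
    have h1 : HasFDerivAt (F ∘ G) (L.comp M) 0 := HasFDerivAt.comp 0 (by rwa [hG0]) hGM
    rw [hFG.comp_eq_id] at h1
    exact h1.unique (hasFDerivAt_id 0)
  have hML' : ∀ z, M (L z) = z := fun z => DFunLike.congr_fun hML z
  have hLM' : ∀ z, L (M z) = z := fun z => DFunLike.congr_fun hLM z
  have hFne : ∀ z, z ≠ 0 → F z ≠ 0 := fun z hz h => hz (by rw [← hGF z, h, hG0])
  -- on the complement, `F z` is proportional to `L z`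
  have hprop : ∀ z, z ∉ domainD n → ∃ c : ℂ, F z = c • L z := by
    intro z hz
    rcases eq_or_ne z 0 with rfl | hz0
    · exact ⟨0, by rw [hF0, zero_smul]⟩
    have hne : ∀ t : ℂ, t ≠ 0 → F (t • z) ≠ 0 := fun t ht => hFne _ (smul_ne_zero ht hz0)
    have hder : HasDerivAt (fun t : ℂ => F (t • z)) (L z) 0 := by
      have h2 : HasDerivAt (fun t : ℂ => t • z) z 0 := by
        simpa using (hasDerivAt_id (0 : ℂ)).smul_const z
      have h3 : HasFDerivAt F L ((0 : ℂ) • z) := by rwa [zero_smul]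
      exact h3.comp_hasDerivAt (0 : ℂ) h2
    have hlin : ∀ i, F z i * L z 0 = L z i * F z 0 := by
      intro i
      have h1 := (hasDerivAt_pi.1 hder 0).const_mul (F z i)
      have h2 := (hasDerivAt_pi.1 hder i).mul_const (F z 0)
      refine h1.unique (h2.congr_of_eventuallyEq (Eventually.of_forall fun t => ?_))
      simpa using apply_smul_mul_apply_smul hF (fun z hz => by rwa [hFD]) hz hne i 1 t
    have hF00 : F z 0 ≠ 0 :=
      apply_zero_ne_zero_of_notMem_domainD (by rwa [hFD]) (hFne z hz0)
    have hL0 : L z 0 ≠ 0 := by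
      intro h
      have : L z = 0 := by
        ext i
        have := hlin i
        rw [h, mul_zero] at this
        exact (mul_eq_zero.1 this.symm).resolve_right hF00
      exact hz0 (by rw [← hML' z, this, map_zero])
    refine ⟨F z 0 / L z 0, ?_⟩
    ext i
    simp only [Pi.smul_apply, smul_eq_mul]
    field_simp
    linear_combination hlin i
  let H : (Fin (n + 1) → ℂ) → Fin (n + 1) → ℂ := fun z => M (F z)
  have hH : Differentiable ℂ H := M.differentiable.comp hF
  have hHz : H z = z := by
    refine hH.eq_self_of_preserves_lines (by simp [H, hF0]) ?_ ?_ ?_ ?_ z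
    · rw [← hML]
      exact M.hasFDerivAt.comp 0 hFL
    · intro z hz h
      have := congrArg L h
      rw [hLM', map_zero] at this
      exact hFne z hz this
    · let e : (Fin (n + 1) → ℂ) ≃ₜ (Fin (n + 1) → ℂ) :=
        { toFun := H
          invFun := fun z => G (L z)
          left_inv := fun z => by simp only [H, hLM', hGF z]
          right_inv := fun z => by simp only [H, hFG (L z), hML']
          continuous_toFun := hH.continuous
          continuous_invFun := hG.continuous.comp L.continuous }
      exact e.isClosedEmbedding.tendsto_cocompact
    · intro z i j
      have hHi : ∀ i, Differentiable ℂ fun z => H z i := differentiable_pi.1 hH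
      have h1 : Differentiable ℂ fun z => H z i * z j := (hHi i).mul (by fun_prop)
      have h2 : Differentiable ℂ fun z => H z j * z i := (hHi j).mul (by fun_prop)
      let S : Set (Fin (n + 1) → ℂ) := {z | ∑ i : Fin n, ‖z i.succ‖ ^ 2 < ‖z 0‖ ^ 2}
      have hSo : IsOpen S := isOpen_lt (by fun_prop) (by fun_prop)
      have hq : Pi.single 0 1 ∈ S := by simp [S]
      refine h1.differentiableOn.eqOn_of_isPreconnected_of_eventuallyEq h2.differentiableOn
        isOpen_univ isPreconnected_univ (mem_univ (Pi.single 0 1)) ?_ (mem_univ z)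
      filter_upwards [hSo.mem_nhds hq] with y hy
      obtain ⟨c, hc⟩ := hprop y (by rw [mem_domainD]; exact not_lt.2 (le_of_lt hy))
      simp only [H, hc, map_smul, hML', Pi.smul_apply, smul_eq_mul]
      ring
  rw [← hLM' (F z)]
  exact congrArg L hHz

/-- The Hermitian form `-|z₀|² + |z₁|² + ⋯ + |zₙ|²`. -/
noncomputable def lorentzForm {n : ℕ} (z : Fin (n + 1) → ℂ) : ℝ := -‖z 0‖ ^ 2 + ∑ i : Fin n, ‖z i.succ‖ ^ 2

theorem mem_domainD_iff_lorentzForm_pos {n : ℕ} {z : Fin (n + 1) → ℂ} :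
    z ∈ domainD n ↔ 0 < lorentzForm z := Iff.rfl

theorem continuous_lorentzForm {n : ℕ} :
    Continuous (lorentzForm : (Fin (n + 1) → ℂ) → ℝ) := by
  unfold lorentzForm
  fun_prop

theorem star_dotProduct_matrixJ_mulVec {n : ℕ} (z : Fin (n + 1) → ℂ) :
    star z ⬝ᵥ (matrixJ n *ᵥ z) = (lorentzForm z : ℂ) := by
  simp [matrixJ, Matrix.mulVec_diagonal, dotProduct, Fin.sum_univ_succ, lorentzForm,
    Fin.succ_ne_zero, Complex.conj_mul']

theorem star_dotProduct_conjTranspose_mul_mulVec {n : ℕ} (A : Matrix (Fin (n + 1)) (Fin (n + 1)) ℂ)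
    (z : Fin (n + 1) → ℂ) :
    star z ⬝ᵥ ((Aᴴ * matrixJ n * A) *ᵥ z) = (lorentzForm (A *ᵥ z) : ℂ) := by
  rw [← star_dotProduct_matrixJ_mulVec, Matrix.star_mulVec, ← Matrix.dotProduct_mulVec,
    Matrix.mulVec_mulVec, Matrix.mulVec_mulVec]

theorem lorentzForm_mulVec {n : ℕ} {A : Matrix (Fin (n + 1)) (Fin (n + 1)) ℂ} {ν : ℝ}
    (hA : Aᴴ * matrixJ n * A = (ν : ℂ) • matrixJ n) (z : Fin (n + 1) → ℂ) :
    lorentzForm (A *ᵥ z) = ν * lorentzForm z := by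
  have h := star_dotProduct_conjTranspose_mul_mulVec A z
  rw [hA, Matrix.smul_mulVec, dotProduct_smul, star_dotProduct_matrixJ_mulVec, smul_eq_mul] at h
  exact_mod_cast h.symm

theorem mem_closure_domainD_of_lorentzForm_eq_zero {n : ℕ} {z : Fin (n + 1) → ℂ} (hz : z 0 ≠ 0)
    (h : lorentzForm z = 0) : z ∈ closure (domainD n : Set (Fin (n + 1) → ℂ)) := by
  have hc : Continuous fun t : ℝ => Function.update z 0 ((t : ℂ) * z 0) :=
    continuous_const.update 0 (by fun_prop)
  have hlim : Tendsto (fun t : ℝ => Function.update z 0 ((t : ℂ) * z 0)) (𝓝[<] 1) (𝓝 z) :=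
    (hc.tendsto' 1 z (by simp)).mono_left nhdsWithin_le_nhds
  refine mem_closure_of_tendsto hlim ?_
  have h0 : ∀ᶠ t : ℝ in 𝓝[<] 1, 0 < t := nhdsWithin_le_nhds (lt_mem_nhds one_pos)
  filter_upwards [h0, self_mem_nhdsWithin] with t ht0 (ht1 : t < 1)
  rw [SetLike.mem_coe, mem_domainD]
  have hz' : 0 < ‖z 0‖ ^ 2 := by positivity
  have hs : ∑ i : Fin n, ‖z i.succ‖ ^ 2 = ‖z 0‖ ^ 2 := by
    unfold lorentzForm at h; linarith
  simp only [Function.update_self, Function.update_of_ne (Fin.succ_ne_zero _), hs, norm_mul,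
    Complex.norm_real, Real.norm_eq_abs, mul_pow, sq_abs]
  have : t ^ 2 < 1 := by nlinarith
  nlinarith

/-- A linear map preserving `D^{n,1}` preserves its null cone. -/
theorem lorentzForm_mulVec_eq_zero {n : ℕ} {A : Matrix (Fin (n + 1)) (Fin (n + 1)) ℂ}
    (hA : ∀ z, A *ᵥ z ∈ domainD n ↔ z ∈ domainD n) {z : Fin (n + 1) → ℂ}
    (hz : lorentzForm z = 0) : lorentzForm (A *ᵥ z) = 0 := by
  have hzD : z ∉ domainD n := by rw [mem_domainD_iff_lorentzForm_pos, hz]; exact lt_irrefl _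
  rcases eq_or_ne (z 0) 0 with h0 | h0
  · have : z = 0 := by
      by_contra h
      exact apply_zero_ne_zero_of_notMem_domainD hzD h h0
    simp [this, lorentzForm]
  refine le_antisymm (not_lt.1 fun h => hzD ((hA z).1 h)) ?_
  have hcl : IsClosed {z : Fin (n + 1) → ℂ | 0 ≤ lorentzForm (A *ᵥ z)} :=
    isClosed_le continuous_const (continuous_lorentzForm.comp (by fun_prop))
  have hsub : (domainD n : Set (Fin (n + 1) → ℂ)) ⊆ {z | 0 ≤ lorentzForm (A *ᵥ z)} :=
    fun z hz => le_of_lt (mem_domainD_iff_lorentzForm_pos.1 ((hA z).2 hz))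
  exact closure_minimal hsub hcl (mem_closure_domainD_of_lorentzForm_eq_zero h0 hz)

theorem star_dotProduct_mulVec_single_add_single_add_single {ι : Type*} [Fintype ι] [DecidableEq ι]
    (B : Matrix ι ι ℂ) (i j k : ι) (a u v : ℂ) :
    star (Pi.single i a + Pi.single j u + Pi.single k v) ⬝ᵥ
      (B *ᵥ (Pi.single i a + Pi.single j u + Pi.single k v)) =
      star a * (B i i * a + B i j * u + B i k * v) + star u * (B j i * a + B j j * u + B j k * v) +
        star v * (B k i * a + B k j * u + B k k * v) := by
  simp only [star_add, Pi.star_single, Matrix.mulVec_add, add_dotProduct, single_dotProduct,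
    Pi.add_apply, Matrix.mulVec_single, Pi.smul_apply, Matrix.col_apply,
    op_smul_eq_mul]

/-- A linear map preserving `D^{n,1}` scales the Hermitian form. -/
theorem exists_conjTranspose_mul_matrixJ_mul {n : ℕ} (hn : 0 < n)
    {A : Matrix (Fin (n + 1)) (Fin (n + 1)) ℂ}
    (hA : ∀ z, A *ᵥ z ∈ domainD n ↔ z ∈ domainD n) :
    ∃ ν : ℝ, 0 < ν ∧ Aᴴ * matrixJ n * A = (ν : ℂ) • matrixJ n := by
  set B := Aᴴ * matrixJ n * A with hB
  have hJ0 : matrixJ n 0 0 = -1 := by simp [matrixJ]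
  have hJ : ∀ j, j ≠ 0 → matrixJ n j j = 1 := fun j hj => by simp [matrixJ, hj]
  have hJne : ∀ i j, i ≠ j → matrixJ n i j = 0 := fun i j hij => by simp [matrixJ, hij]
  have hnull : ∀ z, star z ⬝ᵥ (matrixJ n *ᵥ z) = 0 → star z ⬝ᵥ (B *ᵥ z) = 0 := by
    intro z hz
    rw [star_dotProduct_matrixJ_mulVec, Complex.ofReal_eq_zero] at hz
    rw [hB, star_dotProduct_conjTranspose_mul_mulVec, lorentzForm_mulVec_eq_zero hA hz,
      Complex.ofReal_zero]
  have h0j : ∀ j, j ≠ 0 → B 0 j = 0 ∧ B j 0 = 0 ∧ B j j = -B 0 0 := by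
    intro j hj
    have key : ∀ u : ℂ, star u * u = 1 →
        B 0 0 + B 0 j * u + star u * (B j 0 + B j j * u) = 0 := by
      intro u hu
      have := hnull (Pi.single 0 1 + Pi.single j u + Pi.single 0 0) (by
        rw [star_dotProduct_mulVec_single_add_single_add_single, hJ0, hJ j hj, hJne _ _ hj,
          hJne _ _ hj.symm]
        simp only [star_one, star_zero]
        linear_combination hu)
      rw [star_dotProduct_mulVec_single_add_single_add_single] at this
      simpa using this
    have h1 := key 1 (by simp)
    have h2 := key (-1) (by simp)
    have h3 := key Complex.I (by simp)
    simp only [star_one, star_neg, Complex.star_def, Complex.conj_I] at h1 h2 h3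
    have hI := Complex.I_mul_I
    have e1 : B 0 j + B j 0 = 0 := by linear_combination (h1 - h2) / 2
    have e2 : B j j = -B 0 0 := by linear_combination (h1 + h2) / 2
    have e3 : Complex.I * (B 0 j - B j 0) = 0 := by
      linear_combination h3 - e2 + B j j * hI
    have e4 : B 0 j - B j 0 = 0 := (mul_eq_zero.1 e3).resolve_left Complex.I_ne_zero
    exact ⟨by linear_combination (e1 + e4) / 2, by linear_combination (e1 - e4) / 2, e2⟩
  have hjk : ∀ j k, j ≠ 0 → k ≠ 0 → j ≠ k → B j k = 0 := by
    intro j k hj hk hjk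
    obtain ⟨a1, a2, a3⟩ := h0j j hj
    obtain ⟨b1, b2, b3⟩ := h0j k hk
    have key : ∀ u : ℂ, star u * u = 1 → star u * B j k + B k j * u = 0 := by
      intro u hu
      have := hnull (Pi.single 0 5 + Pi.single j (3 * u) + Pi.single k 4) (by
        rw [star_dotProduct_mulVec_single_add_single_add_single, hJ0, hJ j hj, hJ k hk, hJne _ _ hj,
          hJne _ _ hj.symm, hJne _ _ hk, hJne _ _ hk.symm, hJne _ _ hjk, hJne _ _ hjk.symm]
        simp only [star_mul, star_ofNat]
        linear_combination 9 * hu)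
      rw [star_dotProduct_mulVec_single_add_single_add_single, a1, a2, a3, b1, b2, b3] at this
      simp only [star_mul, star_ofNat] at this
      linear_combination this / 12 + 9 / 12 * B 0 0 * hu
    have h1 := key 1 (by simp)
    have h2 := key Complex.I (by simp)
    simp only [star_one, Complex.star_def, Complex.conj_I] at h1 h2
    have e3 : Complex.I * (B k j - B j k) = 0 := by linear_combination h2
    have e4 := (mul_eq_zero.1 e3).resolve_left Complex.I_ne_zero
    linear_combination (h1 - e4) / 2
  let k : Fin (n + 1) := Fin.succ ⟨0, hn⟩
  have hk0 : k ≠ 0 := Fin.succ_ne_zero _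
  let e : Fin (n + 1) → ℂ := Pi.single k 1
  have heD : e ∈ domainD n := mem_domainD_of_norm_lt ⟨0, hn⟩ (by
    change ‖e 0‖ < ‖e k‖
    simp [e, hk0.symm])
  have hkk : B k k = (lorentzForm (A *ᵥ e) : ℂ) := by
    rw [← star_dotProduct_conjTranspose_mul_mulVec, ← hB]
    simp [e]
  refine ⟨lorentzForm (A *ᵥ e), (hA e).2 heD, ?_⟩
  rw [← hkk]
  have hk := (h0j k hk0).2.2
  ext i j
  rw [Matrix.smul_apply, smul_eq_mul]
  rcases eq_or_ne i j with rfl | hij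
  · rcases eq_or_ne i 0 with rfl | hi
    · rw [hJ0, hk]; ring
    · rw [hJ i hi, hk, (h0j i hi).2.2, mul_one]
  · rw [hJne i j hij, mul_zero]
    rcases eq_or_ne i 0 with rfl | hi
    · exact (h0j j hij.symm).1
    · rcases eq_or_ne j 0 with rfl | hj
      · exact (h0j i hi).2.1
      · exact hjk i j hi hj hij

theorem GU.mulVec_mem_domainD_iff {n : ℕ} (A : GU n) {z : Fin (n + 1) → ℂ} :
    ((A : GL (Fin (n + 1)) ℂ) : Matrix (Fin (n + 1)) (Fin (n + 1)) ℂ) *ᵥ z ∈ domainD n ↔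
      z ∈ domainD n := by
  obtain ⟨ν, hν, hA⟩ := A.2
  rw [mem_domainD_iff_lorentzForm_pos, mem_domainD_iff_lorentzForm_pos, lorentzForm_mulVec hA]
  exact mul_pos_iff_of_pos_left hν

theorem isHolomorphicSelfMap_mulVec {n : ℕ} (A : GU n) :
    IsHolomorphicSelfMap (domainD n) fun z =>
      ⟨((A : GL (Fin (n + 1)) ℂ) : Matrix (Fin (n + 1)) (Fin (n + 1)) ℂ) *ᵥ z,
        (GU.mulVec_mem_domainD_iff A).2 z.2⟩ :=
  ⟨fun z => ((A : GL (Fin (n + 1)) ℂ) : Matrix (Fin (n + 1)) (Fin (n + 1)) ℂ) *ᵥ z,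
    (Matrix.toLin' ((A : GL (Fin (n + 1)) ℂ) : Matrix (Fin (n + 1)) (Fin (n + 1)) ℂ)
      |>.toContinuousLinearMap.differentiable.differentiableOn), fun _ => rfl⟩

/-- The automorphism of `D^{n,1}` defined by a matrix in `GU(n,1)`. -/
def GU.toAut (n : ℕ) : GU n →* Aut (domainD n) where
  toFun A :=
    ⟨{ toFun := fun z =>
        ⟨((A : GL (Fin (n + 1)) ℂ) : Matrix (Fin (n + 1)) (Fin (n + 1)) ℂ) *ᵥ z,
          (GU.mulVec_mem_domainD_iff A).2 z.2⟩
       invFun := fun z =>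
        ⟨((A⁻¹ : GU n) : GL (Fin (n + 1)) ℂ).1 *ᵥ z, (GU.mulVec_mem_domainD_iff A⁻¹).2 z.2⟩
       left_inv := fun z => Subtype.ext <| by
        simp [Matrix.mulVec_mulVec]
       right_inv := fun z => Subtype.ext <| by
        simp [Matrix.mulVec_mulVec] },
      isHolomorphicSelfMap_mulVec A, isHolomorphicSelfMap_mulVec A⁻¹⟩
  map_one' := Subtype.ext <| Equiv.ext fun z => Subtype.ext <| by simp
  map_mul' A B := Subtype.ext <| Equiv.ext fun z => Subtype.ext <| by simp

theorem GU.toAut_apply {n : ℕ} (A : GU n) (z : domainD n) :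
    (((GU.toAut n A : Equiv.Perm (domainD n)) z : domainD n) : Fin (n + 1) → ℂ) =
      ((A : GL (Fin (n + 1)) ℂ) : Matrix (Fin (n + 1)) (Fin (n + 1)) ℂ) *ᵥ z := rfl

/-- The point `e_j` of `D^{n,1}`, `j ≥ 1`. -/
noncomputable def domainD.basisPoint {n : ℕ} (j : Fin n) : domainD n :=
  ⟨Pi.single j.succ 1, mem_domainD_of_norm_lt j (by simp [(Fin.succ_ne_zero j).symm])⟩

/-- The point `e_0 + 2 e_j` of `D^{n,1}`, `j ≥ 1`. -/
noncomputable def domainD.shiftedBasisPoint {n : ℕ} (j : Fin n) : domainD n :=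
  ⟨Pi.single 0 1 + (2 : ℂ) • Pi.single j.succ 1,
    mem_domainD_of_norm_lt j (by simp [(Fin.succ_ne_zero j).symm])⟩

/-- The matrix entries of a linear automorphism are differences of its values at points of
`D^{n,1}`. -/
noncomputable def Aut.entries {n : ℕ} (j : Fin n) (f : Aut (domainD n)) :
    Matrix (Fin (n + 1)) (Fin (n + 1)) ℂ :=
  Matrix.of fun i => Fin.cons
    (((f : Equiv.Perm (domainD n)) (domainD.shiftedBasisPoint j)).1 i -
      2 * ((f : Equiv.Perm (domainD n)) (domainD.basisPoint j)).1 i)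
    fun k => ((f : Equiv.Perm (domainD n)) (domainD.basisPoint k)).1 i

theorem Aut.entries_toAut {n : ℕ} (j : Fin n) (A : GU n) :
    Aut.entries j (GU.toAut n A) =
      ((A : GL (Fin (n + 1)) ℂ) : Matrix (Fin (n + 1)) (Fin (n + 1)) ℂ) := by
  ext i k
  refine Fin.cases ?_ (fun k => ?_) k
  · simp [Aut.entries, GU.toAut_apply, domainD.basisPoint, domainD.shiftedBasisPoint,
      Matrix.mulVec_add, Matrix.mulVec_smul]
  · simp [Aut.entries, GU.toAut_apply, domainD.basisPoint]

theorem Aut.continuous_eval {n : ℕ} (z : domainD n) :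
    Continuous fun f : Aut (domainD n) => ((f : Equiv.Perm (domainD n)) z).1 :=
  have h : Continuous (Aut.toContinuousMap : Aut (domainD n) → C(domainD n, domainD n)) :=
    continuous_induced_dom
  continuous_subtype_val.comp
    ((continuous_eval_const (F := C(domainD n, domainD n)) z).comp h)

theorem Aut.continuous_entries {n : ℕ} (j : Fin n) :
    Continuous (Aut.entries j : Aut (domainD n) → _) := by
  refine continuous_matrix fun i k => ?_
  have h : ∀ z : domainD n,
      Continuous fun f : Aut (domainD n) => ((f : Equiv.Perm (domainD n)) z).1 i :=
    fun z => (continuous_apply i).comp (Aut.continuous_eval z)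
  refine Fin.cases ?_ (fun k => ?_) k
  · exact (h _).sub (continuous_const.mul (h _))
  · exact h _

theorem GU.continuous_toAut (n : ℕ) : Continuous (GU.toAut n) := by
  refine continuous_induced_rng.2 (ContinuousMap.continuous_of_continuous_uncurry _ ?_)
  refine Continuous.subtype_mk (f := fun p : GU n × domainD n =>
    ((p.1 : GL (Fin (n + 1)) ℂ) : Matrix (Fin (n + 1)) (Fin (n + 1)) ℂ) *ᵥ p.2.1) ?_ _
  exact (Units.continuous_val.comp (continuous_subtype_val.comp continuous_fst)).matrix_mulVec
    (continuous_subtype_val.comp continuous_snd)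

theorem GU.toAut_injective {n : ℕ} (hn : 0 < n) : Function.Injective (GU.toAut n) := by
  intro A B h
  refine Subtype.ext (Units.ext ?_)
  rw [← Aut.entries_toAut ⟨0, hn⟩ A, h, Aut.entries_toAut]

/-- Every automorphism of `D^{n,1}`, `n > 1`, is linear. -/
theorem GU.toAut_surjective {n : ℕ} (hn : 1 < n) : Function.Surjective (GU.toAut n) := by
  intro f
  have hn0 : 0 < n := by omega
  obtain ⟨⟨F₀, hF₀, hF₀f⟩, ⟨G₀, hG₀, hG₀f⟩⟩ := f.2
  obtain ⟨F, hF, hFF₀⟩ := exists_differentiable_eqOn_domainD hn hF₀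
  obtain ⟨G, hG, hGG₀⟩ := exists_differentiable_eqOn_domainD hn hG₀
  have hFf : ∀ z : domainD n, F z = ((f : Equiv.Perm (domainD n)) z : Fin (n + 1) → ℂ) :=
    fun z => (hFF₀ z.2).trans (hF₀f z)
  have hGf : ∀ z : domainD n, G z = ((f : Equiv.Perm (domainD n)).symm z : Fin (n + 1) → ℂ) :=
    fun z => (hGG₀ z.2).trans (hG₀f z)
  have hext : ∀ K : (Fin (n + 1) → ℂ) → Fin (n + 1) → ℂ, Differentiable ℂ K →
      (∀ z ∈ domainD n, K z = z) → ∀ z, K z = z := by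
    intro K hK hKD z
    have hp := (domainD.basisPoint (⟨0, hn0⟩ : Fin n)).2
    refine hK.differentiableOn.eqOn_of_isPreconnected_of_eventuallyEq differentiableOn_id
      isOpen_univ isPreconnected_univ
      (mem_univ (domainD.basisPoint (⟨0, hn0⟩ : Fin n) : Fin (n + 1) → ℂ)) ?_ (mem_univ z)
    filter_upwards [(domainD n).isOpen.mem_nhds hp] with z hz using hKD z hz
  have hFG : Function.LeftInverse F G := hext _ (hF.comp hG) fun z hz => by
    have h1 := hGf ⟨z, hz⟩
    have h2 := hFf ((f : Equiv.Perm (domainD n)).symm ⟨z, hz⟩)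
    rw [← h1, Equiv.apply_symm_apply] at h2
    exact h2
  have hGF : Function.LeftInverse G F := hext _ (hG.comp hF) fun z hz => by
    have h1 := hFf ⟨z, hz⟩
    have h2 := hGf ((f : Equiv.Perm (domainD n)) ⟨z, hz⟩)
    rw [← h1, Equiv.symm_apply_apply] at h2
    exact h2
  have hF1 : ∀ z, z ∈ domainD n → F z ∈ domainD n := fun z hz => by
    rw [hFf ⟨z, hz⟩]; exact Subtype.property _
  have hG1 : ∀ z, z ∈ domainD n → G z ∈ domainD n := fun z hz => by
    rw [hGf ⟨z, hz⟩]; exact Subtype.property _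
  have hFD : ∀ z, F z ∈ domainD n ↔ z ∈ domainD n := fun z =>
    ⟨fun h => by simpa only [hGF z] using hG1 _ h, hF1 z⟩
  have hGD : ∀ z, G z ∈ domainD n ↔ z ∈ domainD n := fun z =>
    ⟨fun h => by simpa only [hFG z] using hF1 _ h, hG1 z⟩
  let A := LinearMap.toMatrix' (fderiv ℂ F 0).toLinearMap
  let B := LinearMap.toMatrix' (fderiv ℂ G 0).toLinearMap
  have hA : ∀ z, A *ᵥ z = F z := fun z => by
    rw [eq_fderiv_of_preserves_domainD hn0 hF hG hFG hGF hFD z]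
    exact LinearMap.toMatrix'_mulVec _ z
  have hB : ∀ z, B *ᵥ z = G z := fun z => by
    rw [eq_fderiv_of_preserves_domainD hn0 hG hF hGF hFG hGD z]
    exact LinearMap.toMatrix'_mulVec _ z
  have hAB : A * B = 1 := Matrix.ext_of_mulVec_single fun i => by
    rw [← Matrix.mulVec_mulVec, hB, hA, hFG, Matrix.one_mulVec]
  have hBA : B * A = 1 := Matrix.ext_of_mulVec_single fun i => by
    rw [← Matrix.mulVec_mulVec, hA, hB, hGF, Matrix.one_mulVec]
  obtain ⟨ν, hν, hAν⟩ := exists_conjTranspose_mul_matrixJ_mul hn0 (A := A) fun z => by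
    rw [hA, hFD]
  refine ⟨⟨⟨A, B, hAB, hBA⟩, ν, hν, hAν⟩, ?_⟩
  refine Subtype.ext (Equiv.ext fun z => Subtype.ext ?_)
  rw [GU.toAut_apply, ← hFf]
  exact hA z

theorem theorem2 (n : ℕ) (hn : 1 < n) :
    ∃ φ : GU n ≃ₜ* Aut (domainD n), ∀ (A : GU n) (z : domainD n),
      ((φ A : Equiv.Perm (domainD n)) z : Fin (n + 1) → ℂ) =
        ((A : GL (Fin (n + 1)) ℂ) : Matrix (Fin (n + 1)) (Fin (n + 1)) ℂ) *ᵥ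
          (z : Fin (n + 1) → ℂ) := by
  have hn0 : 0 < n := by omega
  let φ := MulEquiv.ofBijective (GU.toAut n) ⟨GU.toAut_injective hn0, GU.toAut_surjective hn⟩
  have hval : ∀ f, ((φ.symm f : GL (Fin (n + 1)) ℂ) : Matrix (Fin (n + 1)) (Fin (n + 1)) ℂ) =
      Aut.entries ⟨0, hn0⟩ f := by
    intro f
    rw [← Aut.entries_toAut ⟨0, hn0⟩ (φ.symm f)]
    exact congrArg _ (φ.apply_symm_apply f)
  have hcont : Continuous fun f =>
      ((φ.symm f : GL (Fin (n + 1)) ℂ) : Matrix (Fin (n + 1)) (Fin (n + 1)) ℂ) := by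
    simp only [hval]
    exact Aut.continuous_entries _
  refine ⟨{ φ with
    continuous_toFun := GU.continuous_toAut n
    continuous_invFun := ?_ }, fun A z => GU.toAut_apply A z⟩
  refine Continuous.subtype_mk (f := fun f => (φ.symm f : GL (Fin (n + 1)) ℂ)) ?_ _
  refine Units.continuous_iff.2 ⟨hcont, ?_⟩
  simp only [Matrix.coe_units_inv, Matrix.inv_def, Ring.inverse_eq_inv']
  refine Continuous.smul (hcont.matrix_det.inv₀ fun f => ?_) hcont.matrix_adjugate
  exact (Matrix.isUnit_iff_isUnit_det _).1 (Units.isUnit (φ.symm f : GL (Fin (n + 1)) ℂ)) |>.ne_zero
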